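/- Let $d,n$ be integers with $d\ge 0$, $n\ge 1$, let $\mathcal Z$ be a measurable space, $\mu$ a probability measure on $\mathcal Z$, and $\ell:\mathbb R^d\times\mathcal Z\to\mathbb R$ a measurable loss function. A (randomized) learning algorithm is a Markov kernel $\kappa$ from $\mathcal Z^n$ to $\mathbb R^d$: the data set $S_n=(Z_1,\dots,Z_n)$ has law $\mu^n$, and given $S_n=s$ the output $W_n$ has law $P_{n|s}=\kappa(\cdot,s)$. Let $Q_0$ be the marginal law of $W_n$, and let $$\mathrm{gen}(w,s)=\frac1n\sum_{i=1}^n\ell(w,s_i)-\int_{\mathcal Z}\ell(w,z)\,\mathrm d\mu(z)$$ be the generalization error. For $f:\mathbb R^d\to\mathbb R$ put $D^0f=f$ and, for $j\ge 1$ and Euclidean unit vectors $v_1,\dots,v_j$, $$D^jf(w|v_1,\dots,v_j)=\lim_{c\to 0}\frac{D^{j-1}f(w+cv_j|v_1,\dots,v_{j-1})-D^{j-1}f(w|v_1,\dots,v_{j-1})}{c}.$$ Call $f$ infinitely smooth with bounds $(\beta_j)_{j\ge 0}$ if all these directional derivatives exist and $|D^jf(w|v_1,\dots,v_j)|\le\beta_j$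 for all $j\ge 0$, all $w\in\mathbb R^d$ and all unit vectors $v_1,\dots,v_j$. For probability measures $Q,Q'$ on $\mathbb R^d$ let $$\mathbb W_2^2(Q,Q')=\inf_{\pi}\int\|w-w'\|_2^2\,\mathrm d\pi(w,w')\in[0,\infty],$$ the infimum being over all couplings $\pi$ of $Q$ and $Q'$. Suppose that for every $z\in\mathcal Z$ the function $\ell(\cdot,z)$ is infinitely smooth with bounds $\beta_j=\beta_j(z)$ satisfying $\beta_j\le\beta$ for all $j\ge 0$, where $\beta$ does not depend on $z$. Then $$\bigl|\mathbb E[\mathrm{gen}(W_n,S_n)]\bigr|\le\sqrt{\frac{8\,\beta^2\,d\,\mathbb E_{S\sim\mu^n}\bigl[\mathbb W_2^2(P_{n|S},Q_0)\bigr]}{n}}.$$ -/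

import Mathlib

open MeasureTheory ProbabilityTheory
open scoped ENNReal

namespace GenBound

noncomputable section

/-- The `j`-th iterated directional derivative `D^j f(w | v₁, …, v_j)`: `D^0 f = f`, and
`D^{j+1} f(w | v₁, …, v_{j+1})` is the derivative at `w` of `D^j f(· | v₁, …, v_j)` in the
direction `v_{j+1}`. -/
def dirDeriv {d : ℕ} (f : EuclideanSpace ℝ (Fin d) → ℝ) :
    (j : ℕ) → (Fin j → EuclideanSpace ℝ (Fin d)) → EuclideanSpace ℝ (Fin d) → ℝ
  | 0, _ => f
  | j + 1, v => fun w => lineDeriv ℝ (dirDeriv f j (Fin.init v)) w (v (Fin.last j))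

/-- `f` is infinitely smooth with derivative bounds `b 0, b 1, …`: all iterated directional
derivatives along Euclidean unit vectors exist everywhere, and those of order `j` are bounded in
absolute value by `b j`. The order `j = 0` bounds `f` itself. -/
structure InfinitelySmooth {d : ℕ} (f : EuclideanSpace ℝ (Fin d) → ℝ) (b : ℕ → ℝ) : Prop where
  exists_deriv : ∀ (j : ℕ) (v : Fin j → EuclideanSpace ℝ (Fin d)), (∀ i, ‖v i‖ = 1) →
    ∀ u : EuclideanSpace ℝ (Fin d), ‖u‖ = 1 → ∀ w, LineDifferentiableAt ℝ (dirDeriv f j v) w u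
  bound : ∀ (j : ℕ) (v : Fin j → EuclideanSpace ℝ (Fin d)), (∀ i, ‖v i‖ = 1) →
    ∀ w, |dirDeriv f j v w| ≤ b j

/-- The couplings of `Q` and `Q'`: measures on the product with marginals `Q` and `Q'`. -/
def couplings {d : ℕ} (Q Q' : Measure (EuclideanSpace ℝ (Fin d))) :
    Set (Measure (EuclideanSpace ℝ (Fin d) × EuclideanSpace ℝ (Fin d))) :=
  {π | π.map Prod.fst = Q ∧ π.map Prod.snd = Q'}

/-- The squared Wasserstein-2 distance for the Euclidean metric (possibly infinite). -/
def wassersteinSq {d : ℕ} (Q Q' : Measure (EuclideanSpace ℝ (Fin d))) : ℝ≥0∞ :=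
  ⨅ π ∈ couplings Q Q', ∫⁻ p, ‖p.1 - p.2‖ₑ ^ 2 ∂π

/-- The law of an i.i.d. data set of `n` points drawn from `μ`. -/
def dataLaw {Z : Type*} [MeasurableSpace Z] (μ : Measure Z) (n : ℕ) : Measure (Fin n → Z) :=
  Measure.pi (fun _ => μ)

/-- The generalization error of the hypothesis `w` on the data set `s`: the training error minus
the test error. -/
def gen {W Z : Type*} [MeasurableSpace Z] (μ : Measure Z) (ℓ : W → Z → ℝ) {n : ℕ}
    (w : W) (s : Fin n → Z) : ℝ :=
  (1 / (n : ℝ)) * ∑ i, ℓ w (s i) - ∫ z, ℓ w z ∂μ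

/-- The joint law of `(S, W)`, where `S` is the i.i.d. data set and `W` is the output of the
randomized algorithm: given `S = s`, the law of `W` is `κ s`. -/
def jointLaw {W Z : Type*} [MeasurableSpace W] [MeasurableSpace Z] (μ : Measure Z) {n : ℕ}
    (κ : Kernel (Fin n → Z) W) : Measure ((Fin n → Z) × W) :=
  dataLaw μ n ⊗ₘ κ

/-- The marginal law `Q₀` of the output of the algorithm. -/
def outputLaw {W Z : Type*} [MeasurableSpace W] [MeasurableSpace Z] (μ : Measure Z) {n : ℕ}
    (κ : Kernel (Fin n → Z) W) : Measure W :=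
  (jointLaw μ κ).map Prod.snd

end

end GenBound

/-! Gaussian smoothing turns the quadratic transport cost into relative entropy. For ν = N(0, v·I),
the translate of ν by m has relative entropy ‖m‖²/(2v) with respect to ν, so Donsker-Varadhan
duality compares ∫ h(x + m) dν with log ∫ exp h dν at that price (`ShiftBound`). The loss itself is
not smoothed, so it is written as a Gaussian average ℓ = g ∗ ν (`exists_deconvolution`): g is
exp(-(v/2)Δ)ℓ, a series that converges because all derivatives of ℓ share the bound β, and |g| ≤ M =
exp(dv/2)·β.

With a = l²M²/(2n), this gives, for all w, w' (`gen_le_of_shiftBound`), l·gen_ℓ(w, s) - a ≤ ∫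
exp(l·gen_g(w' + x, s) - a) dν(x) - 1 + ‖w - w'‖²/(2v). Integrate against a coupling of the
conditional law and Q₀, then over s. Since Q₀ ∗ ν does not depend on s, Fubini and Hoeffding bound
the exponential term by 1, leaving l·E[gen] - a ≤ E[W₂²]/(2v). The best l gives E[gen]² ≤
(exp(dv)/v)·β²·E[W₂²]/n, and v = 1/d makes the factor e·d ≤ 8d. -/

open scoped NNReal

namespace GenBound

/-! ### Taylor series of functions with uniformly bounded derivatives -/

/-- The Taylor polynomials based at a moving point `s`, evaluated at `t`. -/
lemma hasDerivAt_sum_taylor {φ : ℕ → ℝ → ℝ} (hφ : ∀ k t, HasDerivAt (φ k) (φ (k + 1) t) t)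
    (t s : ℝ) (n : ℕ) :
    HasDerivAt (fun s => ∑ k ∈ Finset.range (n + 1), φ k s * (t - s) ^ k / (k.factorial : ℝ))
      (φ (n + 1) s * (t - s) ^ n / (n.factorial : ℝ)) s := by
  induction n with
  | zero => simpa using hφ 0 s
  | succ n ih =>
    simp_rw [Finset.sum_range_succ _ (n + 1)]
    have h1 : HasDerivAt (fun s : ℝ => (t - s) ^ (n + 1)) (((n + 1 : ℕ) : ℝ) * (t - s) ^ n * (-1)) s := by
      simpa using ((hasDerivAt_id s).const_sub t).fun_pow (n + 1)
    have h2 := ((hφ (n + 1) s).mul h1).div_const ((n + 1).factorial : ℝ)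
    refine (ih.add h2).congr_deriv ?_
    have : ((n + 1).factorial : ℝ) = (n + 1) * n.factorial := by
      push_cast [Nat.factorial_succ]; ring
    rw [this]
    have h3 : (n.factorial : ℝ) ≠ 0 := by positivity
    have h4 : (n + 1 : ℝ) ≠ 0 := by positivity
    push_cast
    field_simp
    ring

/-- Moving the base point from 0 to t changes the Taylor polynomial at a rate of at most B|t|^n/n!,
so the mean value inequality bounds the remainder by B|t|^(n+1)/n!. -/
lemma hasSum_taylor_of_bounded {φ : ℕ → ℝ → ℝ} {B : ℝ}
    (hφ : ∀ k t, HasDerivAt (φ k) (φ (k + 1) t) t) (hB : ∀ k t, |φ k t| ≤ B) (t : ℝ) :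
    HasSum (fun k => φ k 0 * t ^ k / (k.factorial : ℝ)) (φ 0 t) := by
  have hB0 : 0 ≤ B := (abs_nonneg _).trans (hB 0 0)
  have hsum : Summable (fun k => φ k 0 * t ^ k / (k.factorial : ℝ)) := by
    refine Summable.of_norm_bounded ((Real.summable_pow_div_factorial |t|).mul_left B) fun k => ?_
    rw [Real.norm_eq_abs, abs_div, abs_mul, abs_pow, Nat.abs_cast, ← mul_div_assoc]
    gcongr
    exact hB k 0
  refine (hsum.hasSum_iff_tendsto_nat).2 ?_
  rw [← Filter.tendsto_add_atTop_iff_nat 1]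
  have hbound : ∀ n : ℕ, ‖φ 0 t - ∑ k ∈ Finset.range (n + 1), φ k 0 * t ^ k / (k.factorial : ℝ)‖
      ≤ B * |t| * (|t| ^ n / n.factorial) := by
    intro n
    have h := Convex.norm_image_sub_le_of_norm_hasDerivWithin_le (𝕜 := ℝ) (s := Set.uIcc 0 t)
      (C := B * (|t| ^ n / n.factorial)) (x := 0) (y := t)
      (fun s _ => (hasDerivAt_sum_taylor hφ t s n).hasDerivWithinAt) ?_ (convex_uIcc 0 t)
      Set.left_mem_uIcc Set.right_mem_uIcc
    · have h0 : ∑ k ∈ Finset.range (n + 1), φ k t * (t - t) ^ k / (k.factorial : ℝ) = φ 0 t := by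
        rw [Finset.sum_range_succ']
        simp
      simp only [h0, sub_zero, Real.norm_eq_abs] at h ⊢
      refine h.trans (le_of_eq ?_)
      ring
    · intro s hs
      have hs' : |t - s| ≤ |t| := by
        have := Set.abs_sub_right_of_mem_uIcc hs
        simpa using this
      rw [Real.norm_eq_abs, abs_div, abs_mul, abs_pow, Nat.abs_cast, ← mul_div_assoc]
      gcongr
      exact hB _ _
  have hlim : Filter.Tendsto (fun n : ℕ => B * |t| * (|t| ^ n / n.factorial)) Filter.atTop
      (nhds 0) := by
    simpa using (FloorSemiring.tendsto_pow_div_factorial_atTop |t|).const_mul (B * |t|)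
  have := squeeze_zero_norm hbound hlim
  simpa using this.const_sub (φ 0 t)

/-! ### Moments of centred Gaussian laws -/

lemma integrable_pow_gaussianReal (v : ℝ≥0) (k : ℕ) :
    Integrable (fun x : ℝ => x ^ k) (gaussianReal 0 v) := by
  have := (memLp_id_gaussianReal (μ := 0) (v := v) (k : ℝ≥0)).integrable_norm_pow'
  refine (integrable_norm_iff (by fun_prop)).1 ?_
  simpa using this

lemma integrable_exp_abs_gaussianReal (v : ℝ≥0) :
    Integrable (fun x : ℝ => Real.exp |x|) (gaussianReal 0 v) := by
  simpa using integrable_exp_mul_abs (X := fun x : ℝ => x) (t := 1)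
    (by simpa using integrable_exp_mul_gaussianReal 1)
    (by simpa using integrable_exp_mul_gaussianReal (-1))

lemma hasDerivAt_gaussianPDFReal {v : ℝ≥0} (hv : v ≠ 0) (x : ℝ) :
    HasDerivAt (gaussianPDFReal 0 v) (-(x / v) * gaussianPDFReal 0 v x) x := by
  have hv' : (v : ℝ) ≠ 0 := by exact_mod_cast hv
  rw [gaussianPDFReal_def]
  have h1 : HasDerivAt (fun x : ℝ => -(x - 0) ^ 2 / (2 * (v : ℝ))) (-(x / v)) x := by
    have := (((hasDerivAt_id x).sub_const 0).fun_pow 2).neg.div_const (2 * (v : ℝ))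
    refine this.congr_deriv ?_
    simp
    field_simp
  refine (h1.exp.const_mul _).congr_deriv ?_
  ring

lemma integrable_pow_mul_gaussianPDFReal {v : ℝ≥0} (hv : v ≠ 0) (k : ℕ) :
    Integrable (fun x : ℝ => x ^ k * gaussianPDFReal 0 v x) := by
  have h := integrable_pow_gaussianReal v k
  rw [gaussianReal_of_var_ne_zero 0 hv, integrable_withDensity_iff_integrable_smul'
    (measurable_gaussianPDF 0 v) (by simp [gaussianPDF_lt_top])] at h
  simpa [mul_comm] using h

/-- Integration by parts: the density p satisfies p' = -(x/v)p. -/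
lemma integral_pow_add_two_gaussianReal {v : ℝ≥0} (hv : v ≠ 0) (k : ℕ) :
    ∫ x, x ^ (k + 2) ∂(gaussianReal 0 v) = (k + 1) * v * ∫ x, x ^ k ∂(gaussianReal 0 v) := by
  have hv' : (v : ℝ) ≠ 0 := by exact_mod_cast hv
  simp only [integral_gaussianReal_eq_integral_smul hv, smul_eq_mul]
  have h := integral_mul_deriv_eq_deriv_mul_of_integrable (u := fun x : ℝ => x ^ (k + 1))
    (u' := fun x => ((k + 1 : ℕ) : ℝ) * x ^ k) (v := gaussianPDFReal 0 v)
    (v' := fun x => -(x / v) * gaussianPDFReal 0 v x)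
    (fun x _ => by simpa using hasDerivAt_pow (k + 1) x)
    (fun x _ => hasDerivAt_gaussianPDFReal hv x) ?_ ?_ ?_
  · have e1 : ∀ x : ℝ, x ^ (k + 1) * (-(x / v) * gaussianPDFReal 0 v x)
        = -(v : ℝ)⁻¹ * (gaussianPDFReal 0 v x * x ^ (k + 2)) := by
      intro x; field_simp; ring
    have e2 : ∀ x : ℝ, ((k + 1 : ℕ) : ℝ) * x ^ k * gaussianPDFReal 0 v x
        = (k + 1) * (gaussianPDFReal 0 v x * x ^ k) := by
      intro x; push_cast; ring
    simp only [e1, e2, integral_const_mul] at h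
    field_simp at h
    linarith
  · refine ((integrable_pow_mul_gaussianPDFReal hv (k + 2)).const_mul (-(v : ℝ)⁻¹)).congr
      (Filter.Eventually.of_forall fun x => ?_)
    simp only [Pi.mul_apply]
    field_simp
    ring
  · refine ((integrable_pow_mul_gaussianPDFReal hv k).const_mul (k + 1 : ℝ)).congr
      (Filter.Eventually.of_forall fun x => ?_)
    simp only [Pi.mul_apply]
    push_cast
    ring
  · exact integrable_pow_mul_gaussianPDFReal hv (k + 1)

/-- Dividing by (2k)! turns the moment into the k-th coefficient of exp((v/2)∂²): the recursion then
contributes a factor v/(2(k+1)). -/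
lemma integral_pow_gaussianReal_even {v : ℝ≥0} (hv : v ≠ 0) (k : ℕ) :
    (∫ x, x ^ (2 * k) ∂(gaussianReal 0 v)) / ((2 * k).factorial : ℝ)
      = (v / 2 : ℝ) ^ k / (k.factorial : ℝ) := by
  induction k with
  | zero => simp
  | succ k ih =>
    rw [show 2 * (k + 1) = 2 * k + 2 by ring, integral_pow_add_two_gaussianReal hv]
    have h1 : ((2 * k + 2).factorial : ℝ) = (2 * k + 2) * (2 * k + 1) * (2 * k).factorial := by
      rw [show 2 * k + 2 = (2 * k + 1) + 1 by ring, Nat.factorial_succ, Nat.factorial_succ]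
      push_cast; ring
    have h2 : ((k + 1).factorial : ℝ) = (k + 1) * k.factorial := by
      push_cast [Nat.factorial_succ]; ring
    rw [h1, h2, pow_succ]
    have h3 : ((2 * k).factorial : ℝ) ≠ 0 := by positivity
    have h4 : (k.factorial : ℝ) ≠ 0 := by positivity
    have h5 : (2 * k + 1 : ℝ) ≠ 0 := by positivity
    have h6 : (k + 1 : ℝ) ≠ 0 := by positivity
    have h7 : (2 * k + 2 : ℝ) ≠ 0 := by positivity
    rw [div_eq_div_iff h3 h4] at ih
    rw [div_eq_div_iff (by positivity) (by positivity)]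
    push_cast
    linear_combination (2 * k + 1 : ℝ) * v * (k + 1) * ih

lemma integral_pow_gaussianReal_odd {v : ℝ≥0} (hv : v ≠ 0) (k : ℕ) :
    ∫ x, x ^ (2 * k + 1) ∂(gaussianReal 0 v) = 0 := by
  induction k with
  | zero => simp [integral_id_gaussianReal]
  | succ k ih =>
    rw [show 2 * (k + 1) + 1 = 2 * k + 1 + 2 by ring, integral_pow_add_two_gaussianReal hv, ih,
      mul_zero]

/-! ### Gaussian averaging as exp((v/2)∂²), and its inverse -/

/-- Gaussian averages of a function with bounded derivatives. -/
lemma hasSum_integral_gaussianReal {φ : ℕ → ℝ → ℝ} {B : ℝ} {v : ℝ≥0} (hv : v ≠ 0)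
    (hφ : ∀ k t, HasDerivAt (φ k) (φ (k + 1) t) t) (hB : ∀ k t, |φ k t| ≤ B) :
    HasSum (fun m => (v / 2 : ℝ) ^ m / (m.factorial : ℝ) * φ (2 * m) 0)
      (∫ t, φ 0 t ∂(gaussianReal 0 v)) := by
  have hB0 : 0 ≤ B := (abs_nonneg _).trans (hB 0 0)
  have hexp : ∀ t : ℝ, HasSum (fun k : ℕ => B * (|t| ^ k / k.factorial)) (B * Real.exp |t|) := by
    intro t
    have := NormedSpace.expSeries_div_hasSum_exp (𝔸 := ℝ) |t|
    rw [← Real.exp_eq_exp_ℝ] at this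
    exact this.mul_left B
  have h : HasSum (fun k => ∫ t, φ k 0 * t ^ k / (k.factorial : ℝ) ∂(gaussianReal 0 v))
      (∫ t, φ 0 t ∂(gaussianReal 0 v)) := by
    refine hasSum_integral_of_dominated_convergence
      (fun k t => B * (|t| ^ k / k.factorial)) (fun k => by fun_prop) ?_ ?_ ?_ ?_
    · intro k
      refine Filter.Eventually.of_forall fun t => ?_
      rw [Real.norm_eq_abs, abs_div, abs_mul, abs_pow, Nat.abs_cast, ← mul_div_assoc]
      gcongr
      exact hB k 0
    · exact Filter.Eventually.of_forall fun t => (hexp t).summable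
    · simp_rw [fun t => (hexp t).tsum_eq]
      exact (integrable_exp_abs_gaussianReal v).const_mul B
    · exact Filter.Eventually.of_forall fun t => hasSum_taylor_of_bounded hφ hB t
  have hinj : Function.Injective (fun m : ℕ => 2 * m) := fun a b hab => by
    simpa using hab
  -- Odd moments vanish, so only even indices survive.
  rw [← hinj.hasSum_iff] at h
  · refine h.congr_fun ?_ |> fun h' => h'
    intro m
    simp only [Function.comp]
    rw [integral_div, integral_const_mul, ← integral_pow_gaussianReal_even hv]
    ring
  · intro k hk
    have hodd : Odd k := by
      rw [← Nat.not_even_iff_odd]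
      rintro ⟨r, hr⟩
      exact hk ⟨r, by simp [hr, two_mul]⟩
    obtain ⟨r, rfl⟩ := hodd
    rw [integral_div, integral_const_mul, integral_pow_gaussianReal_odd hv]
    simp

/-- The series `∑ (-x)^k / k!` and `∑ x^m / m!` of powers of a shift are inverse to each other. -/
lemma tsum_neg_pow_mul_tsum_pow {a : ℕ → ℝ} {B x : ℝ} (ha : ∀ k, |a k| ≤ B) :
    ∑' k : ℕ, (-x) ^ k / (k.factorial : ℝ) *
      ∑' m : ℕ, x ^ m / (m.factorial : ℝ) * a (k + m) = a 0 := by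
  have hB0 : 0 ≤ B := (abs_nonneg _).trans (ha 0)
  set f : ℕ × ℕ → ℝ := fun p => (-x) ^ p.1 / (p.1.factorial : ℝ) *
    (x ^ p.2 / (p.2.factorial : ℝ) * a (p.1 + p.2)) with hf
  have hfs : Summable f := by
    have h1 := Real.summable_pow_div_factorial |x|
    have h2 := (h1.mul_of_nonneg h1 (fun k => by positivity) (fun k => by positivity)).mul_right B
    refine Summable.of_norm_bounded h2 fun p => ?_
    simp only [hf, norm_mul, norm_div, norm_pow, norm_neg, Real.norm_eq_abs, Nat.abs_cast]
    rw [mul_assoc]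
    gcongr
    exact ha _
  have h1 : ∑' k : ℕ, (-x) ^ k / (k.factorial : ℝ) *
      ∑' m : ℕ, x ^ m / (m.factorial : ℝ) * a (k + m) = ∑' p, f p := by
    rw [hfs.tsum_prod]
    refine tsum_congr fun k => ?_
    rw [← tsum_mul_left]
  rw [h1, ← (Finset.HasAntidiagonal.sigmaAntidiagonalEquivProd (A := ℕ)).tsum_eq f,
    Summable.tsum_sigma' (fun n => (hasSum_fintype _).summable)
      (show Summable fun c => f (Finset.HasAntidiagonal.sigmaAntidiagonalEquivProd c) from
        (Finset.HasAntidiagonal.sigmaAntidiagonalEquivProd (A := ℕ)).summable_iff.2 hfs)]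
  have h2 : ∀ n : ℕ, ∑' c : (Finset.HasAntidiagonal.antidiagonal n),
      f (Finset.HasAntidiagonal.sigmaAntidiagonalEquivProd ⟨n, c⟩) = if n = 0 then a 0 else 0 := by
    intro n
    rw [tsum_fintype]
    simp only [Finset.HasAntidiagonal.sigmaAntidiagonalEquivProd_apply]
    rw [Finset.sum_coe_sort (Finset.HasAntidiagonal.antidiagonal n) f]
    -- On each antidiagonal `a` is constant, and the binomial theorem yields (-x + x)^n, which is
    -- nonzero only for n = 0.
    have h3 : ∑ p ∈ Finset.HasAntidiagonal.antidiagonal n, f p = ((-x) + x) ^ n / (n.factorial : ℝ) * a n := by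
      rw [(Commute.all (-x) x).add_pow', Finset.sum_div, Finset.sum_mul]
      refine Finset.sum_congr rfl fun p hp => ?_
      rw [Finset.HasAntidiagonal.mem_antidiagonal] at hp
      simp only [hf, hp, nsmul_eq_mul]
      have h4 : ((n.choose p.1 : ℕ) : ℝ) = n.factorial / (p.1.factorial * p.2.factorial) := by
        rw [← hp, Nat.cast_add_choose]
      rw [h4]
      have h5 : (n.factorial : ℝ) ≠ 0 := by positivity
      field_simp
    rw [h3]
    rcases Nat.eq_zero_or_pos n with rfl | hn
    · simp
    · simp [hn.ne']
  simp_rw [h2]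
  simp

/-- Gaussian averaging inverts the operator `exp (-(v/2) ∂²)` on functions all of whose derivatives
have a common bound. -/
lemma integral_gaussianReal_tsum {φ : ℕ → ℝ → ℝ} {B : ℝ} {v : ℝ≥0} (hv : v ≠ 0)
    (hφ : ∀ k t, HasDerivAt (φ k) (φ (k + 1) t) t) (hB : ∀ k t, |φ k t| ≤ B) :
    ∫ t, ∑' k : ℕ, (-(v / 2 : ℝ)) ^ k / (k.factorial : ℝ) * φ (2 * k) t ∂(gaussianReal 0 v)
      = φ 0 0 := by
  have hB0 : 0 ≤ B := (abs_nonneg _).trans (hB 0 0)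
  have hcont : ∀ k, Continuous (φ k) := fun k =>
    continuous_iff_continuousAt.2 fun t => (hφ k t).continuousAt
  have hint : ∀ k, Integrable (φ k) (gaussianReal 0 v) := fun k =>
    Integrable.of_bound (hcont k).aestronglyMeasurable B (Filter.Eventually.of_forall (hB k))
  have hle : ∀ k, ∫ t, ‖φ k t‖ ∂(gaussianReal 0 v) ≤ B := fun k => by
    have := integral_mono (hint k).norm (integrable_const B) (fun t => hB k t)
    simpa using this
  rw [← integral_tsum_of_summable_integral_norm (fun k => (hint _).const_mul _)]
  · have h : ∀ k : ℕ, ∫ t, (-(v / 2 : ℝ)) ^ k / (k.factorial : ℝ) * φ (2 * k) t ∂(gaussianReal 0 v)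
        = (-(v / 2 : ℝ)) ^ k / (k.factorial : ℝ) *
          ∑' m : ℕ, (v / 2 : ℝ) ^ m / (m.factorial : ℝ) * φ (2 * (k + m)) 0 := by
      intro k
      rw [integral_const_mul]
      have := hasSum_integral_gaussianReal hv (φ := fun j => φ (2 * k + j))
        (fun j t => hφ (2 * k + j) t) (fun j t => hB _ t)
      simp only [add_zero, ← mul_add] at this
      rw [← this.tsum_eq]
    simp_rw [h]
    exact tsum_neg_pow_mul_tsum_pow (a := fun k => φ (2 * k) 0) (fun k => hB _ 0)
  · refine Summable.of_nonneg_of_le (fun k => by positivity) (fun k => ?_)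
      ((Real.summable_pow_div_factorial |(v / 2 : ℝ)|).mul_right B)
    simp only [norm_mul, integral_const_mul]
    rw [norm_div, norm_pow, norm_neg, Real.norm_eq_abs, Real.norm_eq_abs, Nat.abs_cast]
    gcongr
    exact hle _

/-! ### Change of measure under translations -/

/-- The Donsker-Varadhan type bound with cost `c` for the translation of `ν` by `m`. -/
def ShiftBound {E : Type*} [AddCommGroup E] [MeasurableSpace E] (ν : Measure E) (m : E)
    (c : ℝ) : Prop :=
  ∀ h : E → ℝ, Measurable h → (∃ K, ∀ x, |h x| ≤ K) →
    ∫ x, h (x + m) ∂ν ≤ Real.log (∫ x, Real.exp (h x) ∂ν) + c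

lemma integrable_of_measurable_bounded {α : Type*} [MeasurableSpace α] {ν : Measure α}
    [IsFiniteMeasure ν] {h : α → ℝ} {K : ℝ} (hm : Measurable h) (hK : ∀ x, |h x| ≤ K) :
    Integrable h ν :=
  Integrable.of_bound hm.aestronglyMeasurable K (Filter.Eventually.of_forall hK)

lemma abs_exp_le {x K : ℝ} (h : |x| ≤ K) : |Real.exp x| ≤ Real.exp K := by
  rw [Real.abs_exp]
  exact Real.exp_le_exp.2 ((le_abs_self x).trans h)

lemma integrable_exp_of_bounded {α : Type*} [MeasurableSpace α] {ν : Measure α}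
    [IsFiniteMeasure ν] {h : α → ℝ} {K : ℝ} (hm : Measurable h) (hK : ∀ x, |h x| ≤ K) :
    Integrable (fun x => Real.exp (h x)) ν :=
  integrable_of_measurable_bounded (by fun_prop) fun x => abs_exp_le (hK x)

lemma abs_integral_le_of_bounded {α : Type*} [MeasurableSpace α] {ν : Measure α}
    [IsProbabilityMeasure ν] {h : α → ℝ} {K : ℝ} (hK : ∀ x, |h x| ≤ K) :
    |∫ x, h x ∂ν| ≤ K := by
  simpa using norm_integral_le_of_norm_le_const (μ := ν) (f := h)
    (Filter.Eventually.of_forall hK)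

lemma integral_exp_mem_Icc {α : Type*} [MeasurableSpace α] {ν : Measure α}
    [IsProbabilityMeasure ν] {h : α → ℝ} {K : ℝ} (hm : Measurable h) (hK : ∀ x, |h x| ≤ K) :
    ∫ x, Real.exp (h x) ∂ν ∈ Set.Icc (Real.exp (-K)) (Real.exp K) := by
  have hi := integrable_exp_of_bounded (ν := ν) hm hK
  constructor
  · simpa using integral_mono (integrable_const (μ := ν) (Real.exp (-K))) hi
      (fun x => Real.exp_le_exp.2 (neg_le_of_abs_le (hK x)))
  · simpa using integral_mono hi (integrable_const (μ := ν) (Real.exp K))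
      (fun x => Real.exp_le_exp.2 (le_of_abs_le (hK x)))

lemma integral_exp_pos_of_bounded {α : Type*} [MeasurableSpace α] {ν : Measure α}
    [IsProbabilityMeasure ν] {h : α → ℝ} {K : ℝ} (hm : Measurable h) (hK : ∀ x, |h x| ≤ K) :
    0 < ∫ x, Real.exp (h x) ∂ν :=
  (Real.exp_pos _).trans_le (integral_exp_mem_Icc hm hK).1

lemma abs_log_integral_exp_le {α : Type*} [MeasurableSpace α] {ν : Measure α}
    [IsProbabilityMeasure ν] {h : α → ℝ} {K : ℝ} (hm : Measurable h) (hK : ∀ x, |h x| ≤ K) :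
    |Real.log (∫ x, Real.exp (h x) ∂ν)| ≤ K := by
  have h1 := integral_exp_mem_Icc (ν := ν) hm hK
  have h2 := integral_exp_pos_of_bounded (ν := ν) hm hK
  rw [abs_le]
  exact ⟨(Real.le_log_iff_exp_le h2).2 h1.1, (Real.log_le_iff_le_exp h2).2 h1.2⟩

/-- The linearised form of `ShiftBound`, which is what duality arguments use. -/
lemma ShiftBound.integral_le {E : Type*} [AddCommGroup E] [MeasurableSpace E] {ν : Measure E}
    [IsProbabilityMeasure ν] {m : E} {c : ℝ} (hν : ShiftBound ν m c) {h : E → ℝ}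
    (hm : Measurable h) {K : ℝ} (hK : ∀ x, |h x| ≤ K) :
    ∫ x, h (x + m) ∂ν ≤ ∫ x, Real.exp (h x) ∂ν - 1 + c := by
  have h1 := hν h hm ⟨K, hK⟩
  have h2 := Real.log_le_sub_one_of_pos (integral_exp_pos_of_bounded (ν := ν) hm hK)
  linarith

lemma shiftBound_dirac_zero {E : Type*} [AddCommGroup E] [MeasurableSpace E] :
    ShiftBound (Measure.dirac (0 : E)) 0 0 := by
  intro h hm _
  have h1 : Measurable fun x => Real.exp (h x) := by fun_prop
  simp [integral_dirac' _ _ hm.stronglyMeasurable, integral_dirac' _ _ h1.stronglyMeasurable]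

/-- Data processing: test functions on the image pull back along `L`. -/
lemma ShiftBound.map {E F : Type*} [AddCommGroup E] [MeasurableSpace E] [AddCommGroup F]
    [MeasurableSpace F] [MeasurableAdd₂ F] {ν : Measure E} {m : E} {c : ℝ}
    (hν : ShiftBound ν m c) (L : E →+ F) (hL : Measurable L) :
    ShiftBound (ν.map L) (L m) c := by
  intro h hm hK
  have hm1 : Measurable fun x => h (x + L m) := hm.comp (by fun_prop)
  have hm2 : Measurable fun x => Real.exp (h x) := by fun_prop
  rw [integral_map hL.aemeasurable hm1.aestronglyMeasurable,
    integral_map hL.aemeasurable hm2.aestronglyMeasurable]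
  obtain ⟨K, hK⟩ := hK
  simpa using hν (fun x => h (L x)) (hm.comp hL) ⟨K, fun x => hK _⟩

/-- Additivity of relative entropy. The shift by m₂ is paid for with x fixed; this replaces h by the
log-partial integral `H`, to which the bound for ν₁ applies. Since exp H is the inner integral, the
two logarithms collapse into one. -/
lemma ShiftBound.conv {E : Type*} [AddCommGroup E] [MeasurableSpace E] [MeasurableAdd₂ E]
    {ν₁ ν₂ : Measure E} [IsProbabilityMeasure ν₁] [IsProbabilityMeasure ν₂] {m₁ m₂ : E}
    {c₁ c₂ : ℝ} (h₁ : ShiftBound ν₁ m₁ c₁) (h₂ : ShiftBound ν₂ m₂ c₂) :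
    ShiftBound (ν₁.conv ν₂) (m₁ + m₂) (c₁ + c₂) := by
  rintro h hm ⟨K, hK⟩
  have hms : Measurable fun x => h (x + (m₁ + m₂)) := hm.comp (by fun_prop)
  rw [integral_conv (integrable_of_measurable_bounded hms fun x => hK _),
    integral_conv (integrable_exp_of_bounded hm hK)]
  have hmx : ∀ x, Measurable fun y => h (x + y) := fun x => hm.comp (by fun_prop)
  set H : E → ℝ := fun x => Real.log (∫ y, Real.exp (h (x + y)) ∂ν₂) with hH
  have hexp : ∀ x, Real.exp (H x) = ∫ y, Real.exp (h (x + y)) ∂ν₂ := fun x =>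
    Real.exp_log (integral_exp_pos_of_bounded (hmx x) fun y => hK _)
  have hHm : Measurable H := by
    have : Measurable fun p : E × E => Real.exp (h (p.1 + p.2)) :=
      (hm.comp (by fun_prop : Measurable fun p : E × E => p.1 + p.2)).exp
    exact this.stronglyMeasurable.integral_prod_right.measurable.log
  have hHK : ∀ x, |H x| ≤ K := fun x => abs_log_integral_exp_le (hmx x) fun y => hK _
  have hHm' : Measurable fun x => H (x + m₁) := hHm.comp (by fun_prop)
  have step : ∀ x, ∫ y, h (x + y + (m₁ + m₂)) ∂ν₂ ≤ H (x + m₁) + c₂ := by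
    intro x
    have := h₂ (fun y => h (x + m₁ + y)) (hmx _) ⟨K, fun y => hK _⟩
    refine le_trans (le_of_eq ?_) this
    congr 1 with y
    congr 1
    abel
  have hI : Measurable fun x => ∫ y, h (x + y + (m₁ + m₂)) ∂ν₂ := by
    have : Measurable fun p : E × E => h (p.1 + p.2 + (m₁ + m₂)) := hm.comp (by fun_prop)
    exact this.stronglyMeasurable.integral_prod_right.measurable
  have hHi : Integrable (fun x => H (x + m₁)) ν₁ :=
    integrable_of_measurable_bounded hHm' fun x => hHK _
  calc ∫ x, ∫ y, h (x + y + (m₁ + m₂)) ∂ν₂ ∂ν₁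
      ≤ ∫ x, (H (x + m₁) + c₂) ∂ν₁ :=
        integral_mono (integrable_of_measurable_bounded hI fun x =>
          abs_integral_le_of_bounded fun y => hK _) (hHi.add (integrable_const _)) step
    _ = ∫ x, H (x + m₁) ∂ν₁ + c₂ := by
        rw [integral_add hHi (integrable_const _)]; simp
    _ ≤ Real.log (∫ x, Real.exp (H x) ∂ν₁) + c₁ + c₂ := by
        gcongr
        exact h₁ H hHm ⟨K, hHK⟩
    _ = _ := by
        simp_rw [hexp]
        ring

/-- Normalising h by l = log ∫ exp h makes the exponential integral equal to 1, so log y ≤ y - 1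
loses nothing. -/
lemma shiftBound_of_integral_le {E : Type*} [AddCommGroup E] [MeasurableSpace E] {ν : Measure E}
    [MeasurableAdd₂ E] [IsProbabilityMeasure ν] {m : E} {c : ℝ}
    (H : ∀ h : E → ℝ, Measurable h → (∃ K, ∀ x, |h x| ≤ K) →
      ∫ x, h (x + m) ∂ν ≤ ∫ x, Real.exp (h x) ∂ν - 1 + c) : ShiftBound ν m c := by
  rintro h hm ⟨K, hK⟩
  set l := Real.log (∫ x, Real.exp (h x) ∂ν) with hl
  have hpos := integral_exp_pos_of_bounded (ν := ν) hm hK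
  have h1 := H (fun x => h x - l) (by fun_prop)
    ⟨K + |l|, fun x => (abs_sub _ _).trans (by gcongr; exact hK x)⟩
  have hms : Measurable fun x => h (x + m) := hm.comp (by fun_prop)
  rw [integral_sub (integrable_of_measurable_bounded hms fun x => hK _) (integrable_const _)] at h1
  simp_rw [Real.exp_sub] at h1
  rw [integral_div, hl, Real.exp_log hpos, div_self hpos.ne'] at h1
  simp only [integral_const, probReal_univ, smul_eq_mul, one_mul] at h1
  linarith

/-- Translating the variable gives ∫ exp h = ∫ exp(h(x + m) - ρ(x)), where exp(-ρ) is the density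
ratio. Then y + 1 ≤ exp y suffices, since ρ has mean m²/(2v). -/
lemma shiftBound_gaussianReal {v : ℝ≥0} (hv : v ≠ 0) (m : ℝ) :
    ShiftBound (gaussianReal 0 v) m (m ^ 2 / (2 * v)) := by
  have hv' : (v : ℝ) ≠ 0 := by exact_mod_cast hv
  refine shiftBound_of_integral_le ?_
  rintro h hm ⟨K, hK⟩
  set ρ : ℝ → ℝ := fun x => x * m / v + m ^ 2 / (2 * v) with hρ
  have hpdf : ∀ x, gaussianPDFReal 0 v (x + m) = gaussianPDFReal 0 v x * Real.exp (-ρ x) := by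
    intro x
    simp only [gaussianPDFReal, mul_assoc, ← Real.exp_add, hρ]
    congr 2
    field_simp
    ring
  have hchange : ∫ x, Real.exp (h x) ∂(gaussianReal 0 v)
      = ∫ x, Real.exp (h (x + m) - ρ x) ∂(gaussianReal 0 v) := by
    simp only [integral_gaussianReal_eq_integral_smul hv, smul_eq_mul]
    rw [← integral_add_right_eq_self _ m]
    simp_rw [hpdf, sub_eq_add_neg, Real.exp_add]
    congr 1 with x
    ring
  have hid : Integrable (fun x : ℝ => x) (gaussianReal 0 v) := by
    simpa using integrable_pow_gaussianReal v 1
  have hρi : Integrable ρ (gaussianReal 0 v) :=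
    ((hid.mul_const m).div_const _).add (integrable_const _)
  have hρ_int : ∫ x, ρ x ∂(gaussianReal 0 v) = m ^ 2 / (2 * v) := by
    rw [integral_add ((hid.mul_const m).div_const _) (integrable_const _), integral_div,
      integral_mul_const, integral_id_gaussianReal]
    simp
  have hms : Measurable fun x => h (x + m) := hm.comp (by fun_prop)
  have hhi : Integrable (fun x => h (x + m)) (gaussianReal 0 v) :=
    integrable_of_measurable_bounded hms fun x => hK _
  have hexp : Integrable (fun x => Real.exp (h (x + m) - ρ x)) (gaussianReal 0 v) := by
    have h1 : Integrable (fun x => Real.exp (-(m / v) * x)) (gaussianReal 0 v) :=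
      integrable_exp_mul_gaussianReal _
    have h2 := (h1.mul_const (Real.exp (-(m ^ 2 / (2 * v))))).bdd_mul
      (c := Real.exp K) (f := fun x => Real.exp (h (x + m)))
      (hms.exp.aestronglyMeasurable)
      (Filter.Eventually.of_forall fun x => abs_exp_le (hK _))
    refine h2.congr (Filter.Eventually.of_forall fun x => ?_)
    simp only [hρ, ← Real.exp_add]
    congr 1
    ring
  rw [hchange]
  have hmono := integral_mono ((hhi.sub hρi).add (integrable_const 1)) hexp
    (fun x => Real.add_one_le_exp _)
  have hsplit : ∫ x, (((fun x => h (x + m)) - ρ : ℝ → ℝ) + (fun _ => 1 : ℝ → ℝ)) x ∂(gaussianReal 0 v)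
      = ∫ x, h (x + m) ∂(gaussianReal 0 v) - m ^ 2 / (2 * v) + 1 := by
    rw [integral_add' (hhi.sub hρi) (integrable_const 1), integral_sub' hhi hρi, hρ_int]
    simp
  have := hsplit.symm.le.trans hmono
  linarith

/-! ### Families of functions with bounded iterated partial derivatives -/

/-- The `i`-th partial derivative of a family of functions. -/
noncomputable def partialDeriv {d : ℕ} {Z : Type*} (i : Fin d)
    (F : EuclideanSpace ℝ (Fin d) → Z → ℝ) : EuclideanSpace ℝ (Fin d) → Z → ℝ :=
  fun w z => lineDeriv ℝ (fun w => F w z) w (EuclideanSpace.single i 1)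

/-- All iterated partial derivatives of the measurable family `F` exist and are bounded by `B`. -/
def BoundedPartials {d : ℕ} {Z : Type*} [MeasurableSpace Z]
    (F : EuclideanSpace ℝ (Fin d) → Z → ℝ) (B : ℝ) : Prop :=
  ∃ C : Set (EuclideanSpace ℝ (Fin d) → Z → ℝ), F ∈ C ∧ ∀ G ∈ C,
    Measurable (Function.uncurry G) ∧ (∀ w z, |G w z| ≤ B) ∧
    (∀ i w z, LineDifferentiableAt ℝ (fun w => G w z) w (EuclideanSpace.single i 1)) ∧
    ∀ i, partialDeriv i G ∈ C

section

variable {d : ℕ} {Z : Type*} [MeasurableSpace Z] {F : EuclideanSpace ℝ (Fin d) → Z → ℝ} {B : ℝ}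

namespace BoundedPartials

lemma measurable (h : BoundedPartials F B) : Measurable (Function.uncurry F) := by
  obtain ⟨C, hF, hC⟩ := h
  exact (hC F hF).1

lemma abs_le (h : BoundedPartials F B) (w : EuclideanSpace ℝ (Fin d)) (z : Z) : |F w z| ≤ B := by
  obtain ⟨C, hF, hC⟩ := h
  exact (hC F hF).2.1 w z

lemma lineDifferentiableAt (h : BoundedPartials F B) (i : Fin d) (w : EuclideanSpace ℝ (Fin d))
    (z : Z) : LineDifferentiableAt ℝ (fun w => F w z) w (EuclideanSpace.single i 1) := by
  obtain ⟨C, hF, hC⟩ := h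
  exact (hC F hF).2.2.1 i w z

/-- The class C in the definition is already closed under partial derivatives, so the same C serves
as witness. -/
lemma partialDeriv (h : BoundedPartials F B) (i : Fin d) :
    BoundedPartials (partialDeriv i F) B := by
  obtain ⟨C, hF, hC⟩ := h
  exact ⟨C, (hC F hF).2.2.2 i, hC⟩

lemma iterate_partialDeriv (h : BoundedPartials F B) (i : Fin d) (k : ℕ) :
    BoundedPartials ((GenBound.partialDeriv i)^[k] F) B := by
  induction k with
  | zero => exact h
  | succ k ih =>
    rw [Function.iterate_succ_apply']
    exact ih.partialDeriv i

lemma hasDerivAt (h : BoundedPartials F B) (i : Fin d) (w : EuclideanSpace ℝ (Fin d)) (z : Z)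
    (t : ℝ) : HasDerivAt (fun t : ℝ => F (w + t • EuclideanSpace.single i 1) z)
      (GenBound.partialDeriv i F (w + t • EuclideanSpace.single i 1) z) t := by
  have h1 := (h.lineDifferentiableAt i (w + t • EuclideanSpace.single i 1) z).hasLineDerivAt
  have h2 : HasDerivAt (fun s : ℝ => F (w + t • EuclideanSpace.single i 1
      + s • EuclideanSpace.single i 1) z)
      (GenBound.partialDeriv i F (w + t • EuclideanSpace.single i 1) z) (t - t) := by
    simpa [HasLineDerivAt, GenBound.partialDeriv] using h1
  have h3 := h2.comp_sub_const t t
  refine h3.congr_of_eventuallyEq (Filter.Eventually.of_forall fun s => ?_)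
  simp only
  congr 1
  rw [add_assoc, ← add_smul]
  congr 2
  ring

end BoundedPartials

/-- A partial derivative is the pointwise limit of difference quotients along a fixed sequence of
steps. -/
lemma measurable_partialDeriv (hm : Measurable (Function.uncurry F)) (i : Fin d)
    (hd : ∀ w z, LineDifferentiableAt ℝ (fun w => F w z) w (EuclideanSpace.single i 1)) :
    Measurable (Function.uncurry (partialDeriv i F)) := by
  set c : ℕ → ℝ := fun n => 1 / ((n : ℝ) + 1) with hc
  have hc0 : Filter.Tendsto c Filter.atTop (nhdsWithin 0 {0}ᶜ) := by
    refine tendsto_nhdsWithin_iff.2 ⟨tendsto_one_div_add_atTop_nhds_zero_nat,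
      Filter.Eventually.of_forall fun n => ?_⟩
    simp only [hc, Set.mem_compl_iff, Set.mem_singleton_iff]
    positivity
  refine measurable_of_tendsto_metrizable (f := fun (n : ℕ) (p : EuclideanSpace ℝ (Fin d) × Z) =>
    (c n)⁻¹ * (F (p.1 + c n • EuclideanSpace.single i 1) p.2 - F p.1 p.2)) ?_ ?_
  · intro n
    have h1 : Measurable fun p : EuclideanSpace ℝ (Fin d) × Z =>
        F (p.1 + c n • EuclideanSpace.single i 1) p.2 :=
      hm.comp (g := Function.uncurry F)
        (f := fun p : EuclideanSpace ℝ (Fin d) × Z => (p.1 + c n • EuclideanSpace.single i 1, p.2))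
        (by fun_prop)
    exact (h1.sub hm).const_mul _
  · rw [tendsto_pi_nhds]
    rintro ⟨w, z⟩
    have h1 := (hd w z).hasLineDerivAt.tendsto_slope_zero
    simpa [Function.comp_def, partialDeriv] using h1.comp hc0

lemma BoundedPartials.tsum {c : ℕ → ℝ} (hc : Summable fun k => |c k|)
    {G : ℕ → EuclideanSpace ℝ (Fin d) → Z → ℝ} (hG : ∀ k, BoundedPartials (G k) B) :
    BoundedPartials (fun w z => ∑' k, c k * G k w z) ((∑' k, |c k|) * B) := by
  have hle : ∀ {G : ℕ → EuclideanSpace ℝ (Fin d) → Z → ℝ}, (∀ k, BoundedPartials (G k) B) →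
      ∀ k w z, ‖c k * G k w z‖ ≤ |c k| * B := fun hG k w z => by
    rw [norm_mul, Real.norm_eq_abs]
    gcongr
    exact (hG k).abs_le w z
  -- Termwise differentiation keeps the coefficients and only changes the terms, so the series with
  -- coefficients `c` form a class closed under partial derivatives, with one common bound.
  refine ⟨{H | ∃ G : ℕ → EuclideanSpace ℝ (Fin d) → Z → ℝ, (∀ k, BoundedPartials (G k) B) ∧
    H = fun w z => ∑' k, c k * G k w z}, ⟨G, hG, rfl⟩, ?_⟩
  rintro _ ⟨G, hG, rfl⟩
  have hsum : ∀ w z, Summable fun k => c k * G k w z := fun w z =>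
    Summable.of_norm_bounded (hc.mul_right B) fun k => hle hG k w z
  have hderiv : ∀ i w z, HasLineDerivAt ℝ (fun w => ∑' k, c k * G k w z)
      (∑' k, c k * GenBound.partialDeriv i (G k) w z) w (EuclideanSpace.single i 1) := by
    intro i w z
    have := hasDerivAt_tsum (hc.mul_right B)
      (g := fun k (t : ℝ) => c k * G k (w + t • EuclideanSpace.single i 1) z)
      (g' := fun k (t : ℝ) => c k * GenBound.partialDeriv i (G k) (w + t • EuclideanSpace.single i 1) z)
      (fun k t => ((hG k).hasDerivAt i w z t).const_mul (c k))
      (fun k t => hle (fun k => (hG k).partialDeriv i) k _ z) (y₀ := 0)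
      (hsum _ z) 0
    simpa [HasLineDerivAt] using this
  refine ⟨?_, fun w z => ?_, fun i w z => (hderiv i w z).lineDifferentiableAt, fun i => ?_⟩
  · refine measurable_of_tendsto_metrizable
      (f := fun n (p : EuclideanSpace ℝ (Fin d) × Z) =>
        ∑ k ∈ Finset.range n, c k * G k p.1 p.2) (fun n => ?_) ?_
    · exact Finset.measurable_sum _ fun k _ => ((hG k).measurable).const_mul (c k)
    · rw [tendsto_pi_nhds]
      rintro ⟨w, z⟩
      exact (hsum w z).hasSum.tendsto_sum_nat
  · rw [← tsum_mul_right]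
    exact tsum_of_norm_bounded (hc.mul_right B).hasSum fun k => hle hG k w z
  · refine ⟨fun k => GenBound.partialDeriv i (G k), fun k => (hG k).partialDeriv i, ?_⟩
    funext w z
    exact (hderiv i w z).lineDeriv

/-! ### Gaussian deconvolution, one axis at a time -/

/-- The law of a centred Gaussian vector of variance `v` along the `i`-th coordinate axis. -/
noncomputable def axisGaussian (v : ℝ≥0) (i : Fin d) : Measure (EuclideanSpace ℝ (Fin d)) :=
  (gaussianReal 0 v).map (fun t : ℝ => t • EuclideanSpace.single i 1)

instance (v : ℝ≥0) (i : Fin d) : IsProbabilityMeasure (axisGaussian v i) :=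
  Measure.isProbabilityMeasure_map (by fun_prop)

lemma shiftBound_axisGaussian {v : ℝ≥0} (hv : v ≠ 0) (i : Fin d) (m : ℝ) :
    ShiftBound (axisGaussian v i) (m • EuclideanSpace.single i 1) (m ^ 2 / (2 * v)) :=
  (shiftBound_gaussianReal hv m).map
    ((LinearMap.toSpanSingleton ℝ (EuclideanSpace ℝ (Fin d))
      (EuclideanSpace.single i 1)).toAddMonoidHom)
    (by
      change Measurable (fun t : ℝ => t • (EuclideanSpace.single i 1 : EuclideanSpace ℝ (Fin d)))
      fun_prop)

/-- Deconvolution along one coordinate axis. -/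
lemma BoundedPartials.exists_axis_deconvolution (hF : BoundedPartials F B) {v : ℝ≥0} (hv : v ≠ 0)
    (i : Fin d) : ∃ G, BoundedPartials G (Real.exp (v / 2) * B) ∧
      ∀ w z, ∫ x, G (w + x) z ∂(axisGaussian v i) = F w z := by
  set c : ℕ → ℝ := fun k => (-(v / 2 : ℝ)) ^ k / (k.factorial : ℝ) with hc
  have hcabs : ∀ k, |c k| = (v / 2 : ℝ) ^ k / (k.factorial : ℝ) := by
    intro k
    rw [hc, abs_div, abs_pow, abs_neg, Nat.abs_cast, abs_of_nonneg (by positivity)]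
  -- The absolute coefficients sum to exp(v/2): this is the price of deconvolving along one axis.
  have hcs : HasSum (fun k => |c k|) (Real.exp (v / 2)) := by
    simp_rw [hcabs]
    have := NormedSpace.expSeries_div_hasSum_exp (𝔸 := ℝ) (v / 2 : ℝ)
    rwa [← Real.exp_eq_exp_ℝ] at this
  have hG := BoundedPartials.tsum hcs.summable (fun k => hF.iterate_partialDeriv i (2 * k))
  rw [hcs.tsum_eq] at hG
  refine ⟨_, hG, fun w z => ?_⟩
  have hm : Measurable fun x : EuclideanSpace ℝ (Fin d) =>
      ∑' k, c k * (GenBound.partialDeriv i)^[2 * k] F (w + x) z :=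
    hG.measurable.comp (f := fun x : EuclideanSpace ℝ (Fin d) => (w + x, z)) (by fun_prop)
  rw [axisGaussian, integral_map (by fun_prop) hm.aestronglyMeasurable]
  have := integral_gaussianReal_tsum hv (B := B)
    (φ := fun k t => (GenBound.partialDeriv i)^[k] F (w + t • EuclideanSpace.single i 1) z)
    (fun k t => by
      rw [Function.iterate_succ_apply']
      exact (hF.iterate_partialDeriv i k).hasDerivAt i w z t)
    (fun k t => (hF.iterate_partialDeriv i k).abs_le _ _)
  simpa using this

/-- A law on Euclidean space under which translations are cheap, and with which every family with
bounded partial derivatives is a convolution. -/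
lemma exists_deconvolution (Z : Type*) [MeasurableSpace Z] {v : ℝ≥0} (hv : v ≠ 0)
    (s : Finset (Fin d)) :
    ∃ ν : Measure (EuclideanSpace ℝ (Fin d)), IsProbabilityMeasure ν ∧
      (∀ m : Fin d → ℝ, ShiftBound ν (∑ i ∈ s, m i • EuclideanSpace.single i 1)
        (∑ i ∈ s, m i ^ 2 / (2 * v))) ∧
      ∀ (F : EuclideanSpace ℝ (Fin d) → Z → ℝ) (B : ℝ), BoundedPartials F B →
        ∃ G, BoundedPartials G (Real.exp (v / 2) ^ s.card * B) ∧
          ∀ w z, ∫ x, G (w + x) z ∂ν = F w z := by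
  induction s using Finset.induction_on with
  | empty =>
    refine ⟨Measure.dirac 0, inferInstance, fun m => by simpa using shiftBound_dirac_zero,
      fun F B hF => ⟨F, by simpa using hF, fun w z => ?_⟩⟩
    have hm : Measurable fun x : EuclideanSpace ℝ (Fin d) => F (w + x) z :=
      hF.measurable.comp (f := fun x : EuclideanSpace ℝ (Fin d) => (w + x, z)) (by fun_prop)
    rw [integral_dirac' _ _ hm.stronglyMeasurable, add_zero]
  | insert i s hi ih =>
    obtain ⟨ν, hν, hshift, hdec⟩ := ih
    refine ⟨(axisGaussian v i).conv ν, inferInstance, fun m => ?_, fun F B hF => ?_⟩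
    · rw [Finset.sum_insert hi, Finset.sum_insert hi]
      exact (shiftBound_axisGaussian hv i (m i)).conv (hshift m)
    -- Undo the new axis first, then the remaining ones; the factors exp(v/2) multiply.
    · obtain ⟨G₁, hG₁, h₁⟩ := hF.exists_axis_deconvolution hv i
      obtain ⟨G, hG, h⟩ := hdec G₁ _ hG₁
      refine ⟨G, ?_, fun w z => ?_⟩
      · rwa [Finset.card_insert_of_notMem hi, pow_succ, mul_assoc]
      · have hm : Measurable fun x : EuclideanSpace ℝ (Fin d) => G (w + x) z :=
          hG.measurable.comp (f := fun x : EuclideanSpace ℝ (Fin d) => (w + x, z)) (by fun_prop)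
        rw [integral_conv (integrable_of_measurable_bounded hm fun x => hG.abs_le _ _), ← h₁ w z]
        simp_rw [← add_assoc, h]

/-! ### Smooth losses -/

lemma boundedPartials_of_infinitelySmooth (hm : Measurable (Function.uncurry F)) {b : Z → ℕ → ℝ}
    (hF : ∀ z, InfinitelySmooth (fun w => F w z) (b z)) (hb : ∀ z j, b z j ≤ B) :
    BoundedPartials F B := by
  have hnorm : ∀ {j : ℕ} (I : Fin j → Fin d) (k : Fin j),
      ‖(EuclideanSpace.single (I k) 1 : EuclideanSpace ℝ (Fin d))‖ = 1 := fun I k => by simp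
  -- The class of iterated derivatives along basis vectors. Measurability is carried in the class
  -- because each derivative inherits it from the previous one.
  refine ⟨{G | Measurable (Function.uncurry G) ∧ ∃ (j : ℕ) (I : Fin j → Fin d),
    G = fun w z => dirDeriv (fun w => F w z) j (fun k => EuclideanSpace.single (I k) 1) w},
    ⟨hm, 0, Fin.elim0, rfl⟩, ?_⟩
  rintro _ ⟨hG, j, I, rfl⟩
  have hd := fun i w z => (hF z).exists_deriv j _ (hnorm I) (EuclideanSpace.single i 1)
    (by simp) w
  refine ⟨hG, fun w z => ((hF z).bound j _ (hnorm I) w).trans (hb z j), hd, fun i =>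
    ⟨measurable_partialDeriv hG i (hd i), j + 1, Fin.snoc (α := fun _ => Fin d) I i, ?_⟩⟩
  funext w z
  simp [dirDeriv, partialDeriv, Fin.init_def]

end

section

variable {Z : Type*} [MeasurableSpace Z] {μ : Measure Z} [IsProbabilityMeasure μ]

instance (n : ℕ) : IsProbabilityMeasure (dataLaw μ n) := by
  unfold dataLaw; infer_instance

/-! ### The generalization error of a bounded loss -/

section Gen

variable {W : Type*} {g : W → Z → ℝ} {M : ℝ} {n : ℕ}

omit [IsProbabilityMeasure μ] in
lemma gen_eq_average (hn : 0 < n) (w : W) (s : Fin n → Z) :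
    gen μ g w s = (1 / (n : ℝ)) * ∑ i, (g w (s i) - ∫ z, g w z ∂μ) := by
  have : (n : ℝ) ≠ 0 := by positivity
  rw [gen, Finset.sum_sub_distrib, mul_sub]
  simp
  field_simp

lemma abs_gen_le (hn : 0 < n) (hM : ∀ w z, |g w z| ≤ M) (w : W) (s : Fin n → Z) :
    |gen μ g w s| ≤ 2 * M := by
  have hn' : (0 : ℝ) < n := by positivity
  have h1 : |∑ i, (g w (s i) - ∫ z, g w z ∂μ)| ≤ n * (2 * M) := by
    refine (Finset.abs_sum_le_sum_abs _ _).trans ?_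
    refine (Finset.sum_le_card_nsmul Finset.univ _ (2 * M) fun i _ => ?_).trans ?_
    · have h2 := abs_integral_le_of_bounded (ν := μ) (hM w)
      have := abs_sub (g w (s i)) (∫ z, g w z ∂μ)
      linarith [hM w (s i)]
    · simp
  rw [gen_eq_average hn, abs_mul, abs_of_pos (by positivity)]
  calc 1 / (n : ℝ) * _ ≤ 1 / (n : ℝ) * (n * (2 * M)) := by gcongr
    _ = 2 * M := by field_simp

lemma measurable_gen [MeasurableSpace W] (hg : Measurable (Function.uncurry g)) :
    Measurable fun p : (Fin n → Z) × W => gen μ g p.2 p.1 := by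
  have h1 : Measurable fun w => ∫ z, g w z ∂μ :=
    hg.stronglyMeasurable.integral_prod_right.measurable
  have h2 : ∀ i, Measurable fun p : (Fin n → Z) × W => g p.2 (p.1 i) := fun i =>
    hg.comp (f := fun p : (Fin n → Z) × W => (p.2, p.1 i)) (by fun_prop)
  exact ((Finset.measurable_sum _ fun i _ => h2 i).const_mul _).sub (h1.comp measurable_snd)

/-- Hoeffding's bound for the generalization error at a fixed hypothesis. -/
lemma integral_exp_gen_le (hn : 0 < n) (w : W) (hg : Measurable (g w)) (hM : ∀ z, |g w z| ≤ M)
    (l : ℝ) :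
    ∫ s, Real.exp (l * gen μ g w s) ∂(dataLaw μ n)
      ≤ Real.exp (l ^ 2 * M ^ 2 / (2 * n)) := by
  have hn' : (n : ℝ) ≠ 0 := by positivity
  set Y : Z → ℝ := fun z => g w z - ∫ z, g w z ∂μ with hY
  have hsub := hasSubgaussianMGF_of_mem_Icc (μ := μ) hg.aemeasurable
    (Filter.Eventually.of_forall fun z => abs_le.1 (hM z))
  have hmgf := hsub.mgf_le (l / n)
  have hexp : ∀ s : Fin n → Z, Real.exp (l * gen μ g w s)
      = ∏ i, Real.exp (l / n * Y (s i)) := by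
    intro s
    rw [gen_eq_average hn, ← Real.exp_sum, ← Finset.mul_sum]
    congr 1
    ring
  simp_rw [hexp]
  rw [dataLaw, integral_fintype_prod_eq_prod (fun (_ : Fin n) z => Real.exp (l / n * Y z)),
    Finset.prod_const, Finset.card_univ, Fintype.card_fin]
  refine (pow_le_pow_left₀ (integral_nonneg fun z => (Real.exp_pos _).le) hmgf n).trans
    (le_of_eq ?_)
  rw [← Real.exp_nat_mul]
  congr 1
  have hc : (((‖M - -M‖₊ / 2) ^ 2 : ℝ≥0) : ℝ) = M ^ 2 := by
    push_cast
    rw [Real.norm_eq_abs, div_pow, sq_abs]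
    ring
  rw [hc]
  field_simp

/-- The generalization error is linear in the loss, hence commutes with averaging over the noise. -/
lemma integral_gen_add {E : Type*} [AddCommGroup E] [MeasurableSpace E] [MeasurableAdd₂ E]
    {ν : Measure E} [IsProbabilityMeasure ν] {g ℓ : E → Z → ℝ}
    (hg : Measurable (Function.uncurry g)) (hM : ∀ w z, |g w z| ≤ M)
    (hℓ : ∀ w z, ∫ x, g (w + x) z ∂ν = ℓ w z) (w : E) (s : Fin n → Z) :
    ∫ x, gen μ g (w + x) s ∂ν = gen μ ℓ w s := by
  have hm : Measurable fun p : E × Z => g (w + p.1) p.2 :=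
    hg.comp (f := fun p : E × Z => (w + p.1, p.2)) (by fun_prop)
  have hi : ∀ z, Integrable (fun x => g (w + x) z) ν := fun z =>
    integrable_of_measurable_bounded
      (hm.comp (measurable_id.prodMk measurable_const)) fun x => hM _ _
  have hi2 : Integrable (fun p : E × Z => g (w + p.1) p.2) (ν.prod μ) :=
    integrable_of_measurable_bounded hm fun p => hM _ _
  simp only [gen]
  rw [integral_sub ((integrable_finsetSum _ fun i _ => hi _).const_mul _) hi2.integral_prod_left,
    integral_const_mul, integral_finsetSum _ fun i _ => hi _,
    integral_integral_swap (f := fun x z => g (w + x) z) hi2]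
  simp_rw [hℓ]

end Gen

/-! ### The transport bound -/

/-- No integrability is needed: otherwise the Bochner integral is 0 by convention. -/
lemma ofReal_integral_le_lintegral {α : Type*} [MeasurableSpace α] (ν : Measure α) (f : α → ℝ) :
    ENNReal.ofReal (∫ x, f x ∂ν) ≤ ∫⁻ x, ENNReal.ofReal (f x) ∂ν := by
  by_cases hf : Integrable f ν
  · rw [integral_eq_lintegral_pos_part_sub_lintegral_neg_part hf]
    refine (ENNReal.ofReal_le_ofReal (sub_le_self _ ENNReal.toReal_nonneg)).trans ?_
    exact ENNReal.ofReal_toReal_le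
  · simp [integral_undef hf]

variable {d n : ℕ}

/-- A dual lower bound for the Wasserstein distance. -/
lemma ofReal_le_wassersteinSq {Q Q' : Measure (EuclideanSpace ℝ (Fin d))} [IsProbabilityMeasure Q]
    {f h : EuclideanSpace ℝ (Fin d) → ℝ} (hf : Integrable f Q) (hh : Integrable h Q') {r : ℝ}
    (hfh : ∀ w w', f w ≤ h w' + r * ‖w - w'‖ ^ 2) (hr : 0 < r) :
    ENNReal.ofReal (r⁻¹ * (∫ w, f w ∂Q - ∫ w, h w ∂Q')) ≤ wassersteinSq Q Q' := by
  -- The easy half of Kantorovich duality: integrate `hfh` against an arbitrary coupling.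
  refine le_iInf₂ fun π hπ => ?_
  obtain ⟨h1, h2⟩ := hπ
  have hf' : Integrable (fun p : EuclideanSpace ℝ (Fin d) × EuclideanSpace ℝ (Fin d) => f p.1) π :=
    (h1 ▸ hf : Integrable f (π.map Prod.fst)).comp_measurable measurable_fst
  have hh' : Integrable (fun p : EuclideanSpace ℝ (Fin d) × EuclideanSpace ℝ (Fin d) => h p.2) π :=
    (h2 ▸ hh : Integrable h (π.map Prod.snd)).comp_measurable measurable_snd
  have e1 : ∫ w, f w ∂Q = ∫ p, f p.1 ∂π := by
    rw [← h1]
    exact integral_map measurable_fst.aemeasurable (h1.symm ▸ hf.aestronglyMeasurable)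
  have e2 : ∫ w, h w ∂Q' = ∫ p, h p.2 ∂π := by
    rw [← h2]
    exact integral_map measurable_snd.aemeasurable (h2.symm ▸ hh.aestronglyMeasurable)
  rw [e1, e2, ← integral_sub hf' hh', ← integral_const_mul]
  refine (ofReal_integral_le_lintegral π _).trans (lintegral_mono fun p => ?_)
  rw [← ofReal_norm, ← ENNReal.ofReal_pow (norm_nonneg _)]
  refine ENNReal.ofReal_le_ofReal ?_
  rw [inv_mul_le_iff₀ hr]
  linarith [hfh p.1 p.2]

instance (κ : Kernel (Fin n → Z) (EuclideanSpace ℝ (Fin d))) [IsMarkovKernel κ] :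
    IsProbabilityMeasure (jointLaw μ κ) := by
  unfold jointLaw; infer_instance

instance (κ : Kernel (Fin n → Z) (EuclideanSpace ℝ (Fin d))) [IsMarkovKernel κ] :
    IsProbabilityMeasure (outputLaw μ κ) :=
  Measure.isProbabilityMeasure_map measurable_snd.aemeasurable

/-- Noise centred at w is noise centred at w' translated by w - w'. Averaging `g` over the former
recovers ℓ at w, and the shift bound moves to the latter. The outcome is a pair of dual potentials
for the transport cost. -/
lemma gen_le_of_shiftBound (hn : 0 < n) {E : Type*} [AddCommGroup E] [MeasurableSpace E]
    [MeasurableAdd₂ E] {ν : Measure E} [IsProbabilityMeasure ν] {ℓ g : E → Z → ℝ} {M c : ℝ}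
    (hg : Measurable (Function.uncurry g)) (hM : ∀ w z, |g w z| ≤ M)
    (hℓ : ∀ w z, ∫ x, g (w + x) z ∂ν = ℓ w z) {w w' : E} (hν : ShiftBound ν (w - w') c)
    (s : Fin n → Z) (l a : ℝ) :
    l * gen μ ℓ w s - a ≤ (∫ x, Real.exp (l * gen μ g (w' + x) s - a) ∂ν - 1) + c := by
  have hgm : Measurable fun y => gen μ g y s := (measurable_gen hg).comp measurable_prodMk_left
  have hm : Measurable fun x => l * gen μ g (w' + x) s - a :=
    ((hgm.comp (measurable_const_add w')).const_mul l).sub_const a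
  have := hν.integral_le hm (K := |l| * (2 * M) + |a|) fun x => by
    refine (abs_sub _ _).trans ?_
    rw [abs_mul]
    gcongr
    exact abs_gen_le hn hM _ _
  refine le_trans (le_of_eq ?_) this
  have e : ∀ x, w' + (x + (w - w')) = w + x := fun x => by abel
  have hgi : Integrable (fun x => gen μ g (w + x) s) ν :=
    integrable_of_measurable_bounded (hgm.comp (measurable_const_add w))
      fun x => abs_gen_le hn hM _ _
  simp_rw [e]
  rw [integral_sub (hgi.const_mul l) (integrable_const _), integral_const_mul,
    integral_gen_add hg hM hℓ]
  simp

/-- Averaged over the data, the exponential moment of the generalization error does not exceed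
Hoeffding's bound for any random hypothesis which is independent of the data. -/
lemma integral_integral_exp_gen_le_one (hn : 0 < n) {W : Type*} [MeasurableSpace W]
    {g : W → Z → ℝ} {M : ℝ} (hg : Measurable (Function.uncurry g)) (hM : ∀ w z, |g w z| ≤ M)
    (Q : Measure W) [IsProbabilityMeasure Q] (l : ℝ) :
    ∫ s, ∫ w, Real.exp (l * gen μ g w s - l ^ 2 * M ^ 2 / (2 * n)) ∂Q ∂(dataLaw μ n) ≤ 1 := by
  have hm : Measurable fun p : (Fin n → Z) × W =>
      l * gen μ g p.2 p.1 - l ^ 2 * M ^ 2 / (2 * n) :=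
    ((measurable_gen hg).const_mul l).sub_const _
  have hi : Integrable (fun p : (Fin n → Z) × W =>
      Real.exp (l * gen μ g p.2 p.1 - l ^ 2 * M ^ 2 / (2 * n))) ((dataLaw μ n).prod Q) :=
    integrable_exp_of_bounded hm (K := |l| * (2 * M) + |l ^ 2 * M ^ 2 / (2 * n)|) fun p => by
      refine (abs_sub _ _).trans ?_
      rw [abs_mul]
      gcongr
      exact abs_gen_le hn hM _ _
  rw [integral_integral_swap hi]
  have hw : ∀ w, ∫ s, Real.exp (l * gen μ g w s - l ^ 2 * M ^ 2 / (2 * n)) ∂(dataLaw μ n) ≤ 1 := by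
    intro w
    simp_rw [Real.exp_sub]
    rw [integral_div, div_le_one (Real.exp_pos _)]
    exact integral_exp_gen_le hn _ (hg.comp measurable_prodMk_left) (hM _) l
  simpa using integral_mono hi.integral_prod_right (integrable_const (1 : ℝ)) hw

/-- The transport bound at a fixed inverse temperature `l`, for a loss which is the convolution of
a bounded loss with a law under which translations are cheap. Any data-independent law `Q₀` can
serve as the reference. -/
lemma ofReal_le_lintegral_wassersteinSq (hn : 0 < n)
    (κ : Kernel (Fin n → Z) (EuclideanSpace ℝ (Fin d))) [IsMarkovKernel κ]
    {ℓ g : EuclideanSpace ℝ (Fin d) → Z → ℝ} {M B r : ℝ} (hr : 0 < r)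
    (hℓm : Measurable (Function.uncurry ℓ)) (hB : ∀ w z, |ℓ w z| ≤ B)
    (hg : Measurable (Function.uncurry g)) (hM : ∀ w z, |g w z| ≤ M)
    {ν : Measure (EuclideanSpace ℝ (Fin d))} [IsProbabilityMeasure ν]
    (hν : ∀ m, ShiftBound ν m (r * ‖m‖ ^ 2))
    (hℓ : ∀ w z, ∫ x, g (w + x) z ∂ν = ℓ w z) (Q₀ : Measure (EuclideanSpace ℝ (Fin d)))
    [IsProbabilityMeasure Q₀] (l : ℝ) :
    ENNReal.ofReal (r⁻¹ * (l * ∫ p, gen μ ℓ p.2 p.1 ∂(jointLaw μ κ) - l ^ 2 * M ^ 2 / (2 * n)))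
      ≤ ∫⁻ s, wassersteinSq (κ s) Q₀ ∂(dataLaw μ n) := by
  generalize ha : l ^ 2 * M ^ 2 / (2 * (n : ℝ)) = a
  have hgenℓ : Measurable fun p : (Fin n → Z) × EuclideanSpace ℝ (Fin d) => gen μ ℓ p.2 p.1 :=
    measurable_gen hℓm
  have hgenℓi : ∀ (ρ : Measure ((Fin n → Z) × EuclideanSpace ℝ (Fin d))) [IsFiniteMeasure ρ],
      Integrable (fun p => gen μ ℓ p.2 p.1) ρ := fun ρ _ =>
    integrable_of_measurable_bounded hgenℓ fun p => abs_gen_le hn hB _ _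
  have hm : Measurable fun p : (Fin n → Z) × EuclideanSpace ℝ (Fin d) =>
      Real.exp (l * gen μ g p.2 p.1 - a) := (((measurable_gen hg).const_mul l).sub_const a).exp
  have hK : ∀ (s : Fin n → Z) y, |Real.exp (l * gen μ g y s - a)| ≤ Real.exp (|l| * (2 * M) + |a|) := by
    intro s y
    refine abs_exp_le ((abs_sub _ _).trans ?_)
    rw [abs_mul]
    gcongr
    exact abs_gen_le hn hM _ _
  -- Up to the constant -1, `J s` is the dual potential on the side of `Q₀`.
  obtain ⟨J, hJ⟩ : ∃ J : (Fin n → Z) → EuclideanSpace ℝ (Fin d) → ℝ,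
      ∀ s w', J s w' = ∫ x, Real.exp (l * gen μ g (w' + x) s - a) ∂ν := ⟨_, fun _ _ => rfl⟩
  have hJm : Measurable fun p : (Fin n → Z) × EuclideanSpace ℝ (Fin d) => J p.1 p.2 := by
    have h1 : Measurable fun p : ((Fin n → Z) × EuclideanSpace ℝ (Fin d)) ×
        EuclideanSpace ℝ (Fin d) => Real.exp (l * gen μ g (p.1.2 + p.2) p.1.1 - a) :=
      hm.comp (f := fun p : ((Fin n → Z) × EuclideanSpace ℝ (Fin d)) ×
        EuclideanSpace ℝ (Fin d) => (p.1.1, p.1.2 + p.2)) (by fun_prop)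
    simp_rw [hJ]
    exact h1.stronglyMeasurable.integral_prod_right.measurable
  have hJK : ∀ s w', |J s w'| ≤ Real.exp (|l| * (2 * M) + |a|) := fun s w' => by
    rw [hJ]
    exact abs_integral_le_of_bounded fun x => hK _ _
  have hJs : ∀ s, Integrable (J s) Q₀ := fun s =>
    integrable_of_measurable_bounded
      (hJm.comp (measurable_prodMk_left (x := s))) (hJK s)
  -- The s-independent law Q₀ ∗ ν is the reference to which Hoeffding's bound applies.
  have hJconv : ∀ s, ∫ w, J s w ∂Q₀
      = ∫ y, Real.exp (l * gen μ g y s - a) ∂(Q₀.conv ν) := by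
    intro s
    have hs := hm.comp (measurable_prodMk_left (x := s))
    simp only [Function.comp_def] at hs
    simp_rw [hJ]
    rw [integral_conv (integrable_of_measurable_bounded hs (hK s))]
  have hdual : ∀ s, ENNReal.ofReal (r⁻¹ * ((l * ∫ w, gen μ ℓ w s ∂(κ s) - a)
      - (∫ w, J s w ∂Q₀ - 1))) ≤ wassersteinSq (κ s) Q₀ := by
    intro s
    have hgi : Integrable (fun w => gen μ ℓ w s) (κ s) :=
      integrable_of_measurable_bounded (hgenℓ.comp (measurable_prodMk_left (x := s)))
        fun w => abs_gen_le hn hB _ _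
    have := ofReal_le_wassersteinSq (Q := κ s) (Q' := Q₀)
      ((hgi.const_mul l).sub (integrable_const a)) ((hJs s).sub (integrable_const 1))
      (fun w w' => by
        simp only [Pi.sub_apply, hJ]
        exact gen_le_of_shiftBound hn hg hM hℓ (hν _) s l a) hr
    rw [integral_sub' (hgi.const_mul l) (integrable_const a),
      integral_sub' (hJs s) (integrable_const 1), integral_const_mul] at this
    simpa using this
  -- Neither comparison requires s ↦ `wassersteinSq (κ s) Q₀` to be measurable.
  refine le_trans ?_ (lintegral_mono hdual)
  refine le_trans ?_ (ofReal_integral_le_lintegral _ _)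
  refine ENNReal.ofReal_le_ofReal ?_
  rw [integral_const_mul]
  refine mul_le_mul_of_nonneg_left ?_ (inv_nonneg.2 hr.le)
  have hG : Integrable (fun s => ∫ w, gen μ ℓ w s ∂(κ s)) (dataLaw μ n) :=
    (hgenℓi (dataLaw μ n ⊗ₘ κ)).integral_compProd
  have hGe : ∫ p, gen μ ℓ p.2 p.1 ∂(jointLaw μ κ)
      = ∫ s, ∫ w, gen μ ℓ w s ∂(κ s) ∂(dataLaw μ n) := by
    rw [jointLaw, Measure.integral_compProd (hgenℓi _)]
  have hJi : Integrable (fun p : (Fin n → Z) × EuclideanSpace ℝ (Fin d) => J p.1 p.2)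
      ((dataLaw μ n).prod Q₀) :=
    integrable_of_measurable_bounded hJm fun p => hJK _ _
  have hJ1 : Integrable (fun s => ∫ w, J s w ∂Q₀) (dataLaw μ n) := hJi.integral_prod_left
  have hJle : ∫ s, ∫ w, J s w ∂Q₀ ∂(dataLaw μ n) ≤ 1 := by
    simp_rw [hJconv, ← ha]
    exact integral_integral_exp_gen_le_one hn hg hM _ l
  have hGa : Integrable (fun s => l * ∫ w, gen μ ℓ w s ∂(κ s) - a) (dataLaw μ n) :=
    (hG.const_mul l).sub (integrable_const a)
  have hJ2 : Integrable (fun s => ∫ w, J s w ∂Q₀ - 1) (dataLaw μ n) :=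
    hJ1.sub (integrable_const 1)
  rw [hGe, integral_sub hGa hJ2, integral_sub (hG.const_mul l) (integrable_const a),
    integral_sub hJ1 (integrable_const 1), integral_const_mul]
  simp only [integral_const, probReal_univ, smul_eq_mul, one_mul]
  linarith

end

/-! ### Choice of the parameters and conclusion -/

/-- Optimisation over the inverse temperature. -/
lemma sq_mul_le_of_forall {G M n r V : ℝ} (hM : 0 < M) (hn : 0 < n) (hr : 0 < r)
    (h : ∀ l : ℝ, r⁻¹ * (l * G - l ^ 2 * M ^ 2 / (2 * n)) ≤ V) :
    G ^ 2 ≤ 2 * r * M ^ 2 * V / n := by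
  -- The maximiser of the quadratic in l.
  have h1 := h (n * G / M ^ 2)
  rw [inv_mul_le_iff₀ hr] at h1
  have h2 : n * G / M ^ 2 * G - (n * G / M ^ 2) ^ 2 * M ^ 2 / (2 * n)
      = n * G ^ 2 / (2 * M ^ 2) := by
    field_simp
    ring
  rw [h2, div_le_iff₀ (by positivity)] at h1
  rw [le_div_iff₀ hn]
  linarith

section

variable {Z : Type*} [MeasurableSpace Z] {μ : Measure Z} [IsProbabilityMeasure μ] {d n : ℕ}

/-- The expected generalization error in dimension zero vanishes, because the output of the
algorithm is then deterministic. -/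
lemma integral_gen_eq_zero_of_subsingleton {W : Type*} [MeasurableSpace W] [Subsingleton W]
    [Inhabited W] (hn : 0 < n) (κ : Kernel (Fin n → Z) W) [IsMarkovKernel κ] {ℓ : W → Z → ℝ}
    {B : ℝ} (hℓm : Measurable (Function.uncurry ℓ)) (hB : ∀ w z, |ℓ w z| ≤ B) :
    ∫ p, gen μ ℓ p.2 p.1 ∂(jointLaw μ κ) = 0 := by
  have hi : Integrable (fun p : (Fin n → Z) × W => gen μ ℓ p.2 p.1) (dataLaw μ n ⊗ₘ κ) :=
    integrable_of_measurable_bounded (measurable_gen hℓm) fun p => abs_gen_le hn hB _ _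
  have hs : ∀ s : Fin n → Z, ∫ w, gen μ ℓ w s ∂(κ s) = gen μ ℓ default s := by
    intro s
    simp_rw [fun w : W => Subsingleton.elim w default]
    simp
  have hm : Measurable (ℓ default) := hℓm.comp measurable_prodMk_left
  have hint : ∀ i : Fin n, Integrable (fun s : Fin n → Z => ℓ default (s i)) (dataLaw μ n) :=
    fun i => integrable_of_measurable_bounded (hm.comp (measurable_pi_apply i)) fun s => hB _ _
  have hmarg : ∀ i : Fin n, ∫ s, ℓ default (s i) ∂(dataLaw μ n) = ∫ z, ℓ default z ∂μ := by
    intro i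
    have h := measurePreserving_eval (fun _ : Fin n => μ) i
    have h2 := integral_map (μ := Measure.pi fun _ : Fin n => μ) (φ := Function.eval i)
      h.measurable.aemeasurable (f := ℓ default) hm.aestronglyMeasurable
    rw [h.map_eq] at h2
    exact h2.symm
  have hn' : (n : ℝ) ≠ 0 := by positivity
  rw [jointLaw, Measure.integral_compProd hi]
  simp_rw [hs, gen]
  rw [integral_sub ((integrable_finsetSum _ fun i _ => hint i).const_mul _) (integrable_const _),
    integral_const_mul, integral_finsetSum _ fun i _ => hint i]
  simp_rw [hmarg]
  simp
  field_simp
  simp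

lemma norm_sq_eq_sum_single (m : EuclideanSpace ℝ (Fin d)) (v : ℝ) :
    ∑ i, m i ^ 2 / (2 * v) = (2 * v)⁻¹ * ‖m‖ ^ 2 := by
  rw [EuclideanSpace.real_norm_sq_eq, Finset.mul_sum]
  exact Finset.sum_congr rfl fun i _ => by ring

lemma sum_smul_single (m : EuclideanSpace ℝ (Fin d)) :
    ∑ i, m i • (EuclideanSpace.single i 1 : EuclideanSpace ℝ (Fin d)) = m := by
  simpa using (EuclideanSpace.basisFun (Fin d) ℝ).sum_repr m

/-- The bound with the explicit constant `e` in place of `8`, in positive dimension. -/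
lemma sq_integral_gen_le (hn : 0 < n) (hd : 0 < d)
    (κ : Kernel (Fin n → Z) (EuclideanSpace ℝ (Fin d))) [IsMarkovKernel κ]
    {ℓ : EuclideanSpace ℝ (Fin d) → Z → ℝ} {β : ℝ} (hβ : 0 < β) (hℓ : BoundedPartials ℓ β)
    (hV : ∫⁻ s, wassersteinSq (κ s) (outputLaw μ κ) ∂(dataLaw μ n) ≠ ∞) :
    (∫ p, gen μ ℓ p.2 p.1 ∂(jointLaw μ κ)) ^ 2 ≤ Real.exp 1 * β ^ 2 * d *
      (∫⁻ s, wassersteinSq (κ s) (outputLaw μ κ) ∂(dataLaw μ n)).toReal / n := by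
  have hd' : (0 : ℝ) < d := by exact_mod_cast hd
  -- v = 1/d minimises exp(dv)/v, the factor produced by M² = exp(dv)β² and r = 1/(2v).
  set v : ℝ≥0 := (d : ℝ≥0)⁻¹ with hv
  have hvr : (v : ℝ) = (d : ℝ)⁻¹ := by simp [hv]
  have hv0 : v ≠ 0 := inv_ne_zero (by exact_mod_cast hd.ne')
  have hv0' : (0 : ℝ) < v := by rw [hvr]; positivity
  obtain ⟨ν, hν, hshift, hdec⟩ := exists_deconvolution (d := d) Z hv0 Finset.univ
  obtain ⟨g, hg, hgℓ⟩ := hdec ℓ β hℓ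
  set M : ℝ := Real.exp (v / 2) ^ (Finset.univ : Finset (Fin d)).card * β with hM
  have hM2 : M ^ 2 = Real.exp 1 * β ^ 2 := by
    rw [hM, Finset.card_univ, Fintype.card_fin, mul_pow, ← pow_mul, ← Real.exp_nat_mul]
    congr 2
    push_cast
    rw [hvr]
    field_simp
  have hM0 : 0 < M := by positivity
  have hshift' : ∀ m, ShiftBound ν m ((2 * v : ℝ)⁻¹ * ‖m‖ ^ 2) := fun m => by
    have := hshift m
    rwa [norm_sq_eq_sum_single, sum_smul_single] at this
  have hr : (0 : ℝ) < (2 * v : ℝ)⁻¹ := by positivity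
  have h := sq_mul_le_of_forall (V := (∫⁻ s, wassersteinSq (κ s) (outputLaw μ κ)
    ∂(dataLaw μ n)).toReal) hM0 (n := n) (by exact_mod_cast hn) hr fun l => by
      rw [← ENNReal.ofReal_le_iff_le_toReal hV]
      exact ofReal_le_lintegral_wassersteinSq hn κ hr hℓ.measurable hℓ.abs_le hg.measurable
        hg.abs_le hshift' hgℓ _ l
  refine h.trans (le_of_eq ?_)
  rw [hM2, hvr]
  field_simp

end

end GenBound

theorem corollary4 {Z : Type*} [MeasurableSpace Z] (μ : Measure Z) [IsProbabilityMeasure μ]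
    (d n : ℕ) (hn : 0 < n)
    (ℓ : EuclideanSpace ℝ (Fin d) → Z → ℝ) (hℓ_meas : Measurable (Function.uncurry ℓ))
    (κ : Kernel (Fin n → Z) (EuclideanSpace ℝ (Fin d))) [IsMarkovKernel κ]
    (b : Z → ℕ → ℝ) (β : ℝ)
    (hℓ : ∀ z, GenBound.InfinitelySmooth (fun w => ℓ w z) (b z))
    (hb : ∀ z j, b z j ≤ β) :
    ENNReal.ofReal |∫ p, GenBound.gen μ ℓ p.2 p.1 ∂(GenBound.jointLaw μ κ)| ≤
      (ENNReal.ofReal (8 * β ^ 2 * d) *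
          (∫⁻ s, GenBound.wassersteinSq (κ s) (GenBound.outputLaw μ κ) ∂(GenBound.dataLaw μ n)) /
        (n : ℝ≥0∞)) ^ (1 / 2 : ℝ) := by
  have hbp : GenBound.BoundedPartials ℓ β :=
    GenBound.boundedPartials_of_infinitelySmooth hℓ_meas hℓ hb
  have hn' : (0 : ℝ) < n := by exact_mod_cast hn
  -- For d = 0 the right side is 0 and the variance 1/d is unavailable.
  rcases Nat.eq_zero_or_pos d with rfl | hd
  · rw [GenBound.integral_gen_eq_zero_of_subsingleton hn κ hℓ_meas hbp.abs_le]
    simp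
  have hd' : (0 : ℝ) < d := by exact_mod_cast hd
  have hZ : Nonempty Z := nonempty_of_isProbabilityMeasure μ
  have hβ0 : 0 ≤ β := (abs_nonneg _).trans (hbp.abs_le 0 hZ.some)
  -- The optimal l needs M > 0; for β = 0 the loss vanishes identically.
  rcases hβ0.eq_or_lt with rfl | hβ
  · have h0 : ∀ w z, ℓ w z = 0 := fun w z => abs_nonpos_iff.1 (hbp.abs_le w z)
    simp [GenBound.gen, h0]
  set G := ∫ p, GenBound.gen μ ℓ p.2 p.1 ∂(GenBound.jointLaw μ κ) with hG
  set V := ∫⁻ s, GenBound.wassersteinSq (κ s) (GenBound.outputLaw μ κ)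
    ∂(GenBound.dataLaw μ n) with hV
  -- With d and β positive, an infinite transport cost makes the right side infinite.
  by_cases hVtop : V = ∞
  · have h8 : ENNReal.ofReal (8 * β ^ 2 * d) ≠ 0 := by
      rw [Ne, ENNReal.ofReal_eq_zero, not_le]
      positivity
    rw [hVtop, ENNReal.mul_top h8, ENNReal.top_div_of_ne_top (ENNReal.natCast_ne_top n),
      ENNReal.top_rpow_of_pos (by norm_num)]
    exact le_top
  have h1 : G ^ 2 ≤ 8 * β ^ 2 * d * V.toReal / n := by
    refine (GenBound.sq_integral_gen_le hn hd κ hβ hbp hVtop).trans ?_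
    have := Real.exp_one_lt_d9
    gcongr
    linarith
  have h2 : ENNReal.ofReal (8 * β ^ 2 * d) * V / (n : ℝ≥0∞)
      = ENNReal.ofReal (8 * β ^ 2 * d * V.toReal / n) := by
    rw [ENNReal.ofReal_div_of_pos hn', ENNReal.ofReal_mul (p := 8 * β ^ 2 * d) (by positivity),
      ENNReal.ofReal_toReal hVtop, ENNReal.ofReal_natCast]
  rw [h2, ENNReal.ofReal_rpow_of_nonneg (by positivity) (by norm_num)]
  refine ENNReal.ofReal_le_ofReal ?_
  rw [← Real.sqrt_eq_rpow]
  exact Real.abs_le_sqrt h1
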